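/- Let $m\ge 1$ be an integer and let $a_1,\dots,a_m,b_1,\dots,b_m\in\mathbb C$ satisfy $\sum_{j=1}^m \Re(a_j+b_j+1)>1$. Define the entire function $$f(x)=\prod_{j=1}^m\frac1{\Gamma(1+a_j+x)\,\Gamma(1+b_j-x)},$$ where $1/\Gamma$ is $0$ at the poles of $\Gamma$. Let $p\ge m$ be an integer and let $t\in\mathbb R$ with $|t|\le p\pi$. For $k\in\mathbb Z$ put $$S_k(t)=\frac1p\sum_{\ell=-\infty}^{\infty} f\big(\ell+\tfrac kp\big)\,e^{-i(\ell+\frac kp)t},\qquad C_k=\frac{1}{\prod_{j=1}^m\Gamma(a_j+1+\frac kp)\,\Gamma(b_j+1-\frac kp)} .$$ Then the function $x\mapsto f(x)e^{-ixt}$ is integrable on $\mathbb R$, the series defining each $S_k(t)$ converges absolutely, and $$\int_{-\infty}^\infty f(x)\,e^{-ixt}\,dx=\sum_{k=0}^{p-1}S_k(t).$$ Moreover, for every $k\in\mathbb Z$ such that no $-b_j+\frac kp$ is a positive integer and no $a_j+1+\frac kp$ is a nonpositive integer, the series ${}_mH_m$ below converges absolutely and $$S_k(t)=\frac1p\,C_k\,e^{-i\frac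 kp t}\;{}_mH_m\!\left({-b_1+\frac kp,\dots,-b_m+\frac kp\atop a_1+1+\frac kp,\dots,a_m+1+\frac kp};\,(-1)^m e^{-it}\right).$$ Here $${}_mH_m\!\left({c_1,\dots,c_m\atop d_1,\dots,d_m};z\right)=\sum_{n=-\infty}^\infty\frac{(c_1)_n\cdots(c_m)_n}{(d_1)_n\cdots(d_m)_n}\,z^n,$$ with $(c)_n=c(c+1)\cdots(c+n-1)$ for $n\ge0$ and $(c)_{-n}=\dfrac1{(c-1)(c-2)\cdots(c-n)}$ for $n\ge1$ (i.e. $(c)_n=\Gamma(c+n)/\Gamma(c)$ for $n\in\mathbb Z$, removable singularities being removed), and $1/(d)_n:=0$ where $(d)_n$ has a pole. -/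

import Mathlib

/-- The shifted factorial `(c)_n` for `n : ℤ`, that is `Γ(c+n)/Γ(c)` with removable singularities
in `c` removed: `(c)_n = c (c+1) ⋯ (c+n-1)` for `n ≥ 0` and
`(c)_{-n} = 1 / ((c-1)(c-2) ⋯ (c-n))` for `n ≥ 1`. (A genuine pole of the latter is given the
value `0`, so that the reciprocal `1/(c)_{-n}` has its correct value `0` there.) -/
noncomputable def shiftedFactorial (c : ℂ) : ℤ → ℂ
  | Int.ofNat n => ∏ i ∈ Finset.range n, (c + i)
  | Int.negSucc n => (∏ i ∈ Finset.range (n + 1), (c - (i + 1)))⁻¹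

/-- Where `Γ(c)` and `Γ(c+n)` are finite, the shifted factorial is `Γ(c+n)/Γ(c)`. -/
theorem shiftedFactorial_eq_Gamma_div (c : ℂ) (n : ℤ) (hc : ∀ k : ℕ, c ≠ -k)
    (hcn : ∀ k : ℕ, c + n ≠ -k) :
    shiftedFactorial c n = Complex.Gamma (c + n) / Complex.Gamma c := by
  have key : ∀ (d : ℂ) (m : ℕ), (∀ k : ℕ, d ≠ -k) →
      Complex.Gamma (d + m) = (∏ i ∈ Finset.range m, (d + i)) * Complex.Gamma d := by
    intro d m hd
    induction m with
    | zero => simp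
    | succ m ih =>
      have h0 : d + m ≠ 0 := fun h => hd m (eq_neg_of_add_eq_zero_left h)
      rw [Finset.prod_range_succ, Nat.cast_succ, ← add_assoc, Complex.Gamma_add_one _ h0, ih]
      ring
  cases n with
  | ofNat n =>
    have h := key c n hc
    have hG := Complex.Gamma_ne_zero hc
    simp only [shiftedFactorial, Int.ofNat_eq_natCast, Int.cast_natCast]
    rw [h]
    field_simp
  | negSucc n =>
    have h := key (c + (Int.negSucc n : ℤ)) (n + 1) hcn
    have hG := Complex.Gamma_ne_zero hcn
    have e : c + (Int.negSucc n : ℤ) + ((n + 1 : ℕ) : ℂ) = c := by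
      rw [Int.cast_negSucc]; ring
    rw [e] at h
    have e2 : ∏ i ∈ Finset.range (n + 1), (c + (Int.negSucc n : ℤ) + i)
        = ∏ i ∈ Finset.range (n + 1), (c - (i + 1)) := by
      rw [← Finset.prod_range_reflect]
      refine Finset.prod_congr rfl fun i hi => ?_
      have hi' : i ≤ n := Nat.lt_succ_iff.mp (Finset.mem_range.mp hi)
      rw [Int.cast_negSucc, show n + 1 - 1 - i = n - i by omega, Nat.cast_sub hi']
      push_cast
      ring
    rw [e2] at h
    rw [shiftedFactorial, h, mul_comm, ← div_div, div_self hG, one_div]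

/-- The `n`-th term `(c_1)_n ⋯ (c_p)_n / ((d_1)_n ⋯ (d_q)_n) * z ^ n` of the bilateral
hypergeometric series. -/
noncomputable def bilateralTerm {p q : ℕ} (c : Fin p → ℂ) (d : Fin q → ℂ) (z : ℂ) (n : ℤ) : ℂ :=
  (∏ j, shiftedFactorial (c j) n) / (∏ j, shiftedFactorial (d j) n) * z ^ n

/-- The sum of the bilateral hypergeometric series `ₚH_q(c; d; z)`. -/
noncomputable def bilateralH {p q : ℕ} (c : Fin p → ℂ) (d : Fin q → ℂ) (z : ℂ) : ℂ :=
  ∑' n : ℤ, bilateralTerm c d z n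

/-- The series `ₚH_q(c; d; z)` is well-defined: no `c_j` is a positive integer and no `d_j` is
a nonpositive integer. -/
def BilateralWellDefined {p q : ℕ} (c : Fin p → ℂ) (d : Fin q → ℂ) : Prop :=
  (∀ j, ∀ n : ℕ, c j ≠ (n : ℂ) + 1) ∧ (∀ j, ∀ n : ℕ, d j ≠ -(n : ℂ))

/-- The entire function `f(x) = 1 / ∏ j, Γ(1 + a_j + x) Γ(1 + b_j - x)`. Mathlib's `Γ` is `0` at
its poles, so the quotient takes there the value `0` of the entire function. -/
noncomputable def gammaProd {m : ℕ} (a b : Fin m → ℂ) (x : ℂ) : ℂ :=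
  ∏ j, 1 / (Complex.Gamma (1 + a j + x) * Complex.Gamma (1 + b j - x))

/-- The summand `f(ℓ + k/p) e^{-i (ℓ + k/p) t}`. -/
noncomputable def riemannTerm {m : ℕ} (a b : Fin m → ℂ) (p : ℕ) (t : ℝ) (k ℓ : ℤ) : ℂ :=
  gammaProd a b ((ℓ : ℂ) + (k : ℂ) / p) *
    Complex.exp (-Complex.I * ((ℓ : ℂ) + (k : ℂ) / p) * t)

/-- `S_k(t) = (1/p) ∑_{ℓ ∈ ℤ} f(ℓ + k/p) e^{-i (ℓ + k/p) t}`. -/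
noncomputable def riemannPart {m : ℕ} (a b : Fin m → ℂ) (p : ℕ) (t : ℝ) (k : ℤ) : ℂ :=
  1 / (p : ℂ) * ∑' ℓ : ℤ, riemannTerm a b p t k ℓ

/-- `C_k = 1 / ∏ j, Γ(a_j + 1 + k/p) Γ(b_j + 1 - k/p)`. -/
noncomputable def coeffC {m : ℕ} (a b : Fin m → ℂ) (p : ℕ) (k : ℤ) : ℂ :=
  1 / ∏ j, (Complex.Gamma (a j + 1 + (k : ℂ) / p) * Complex.Gamma (b j + 1 - (k : ℂ) / p))

/-! The theorem is Poisson summation for a band-limited function. With `σ = ∑ Re (a_j + b_j + 1) >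
1`, the function f is `O((1+|x|)^(-σ) (1+|y|)^K e^(mπ|y|))` on the whole plane
(`stripBound_gammaProd`). Hence f is integrable on the real line, and pushing the line of
integration to `∓i∞` shows that its Fourier integral vanishes for `|τ| ≥ mπ`
(`integral_gammaProd_mul_exp_eq_zero`).

Apply Poisson summation to `g(x) = f(x/p) e^(-ixt/p)`. Up to the factor p, its n-th Fourier
coefficient is the Fourier integral of f at `t + 2πpn`. For `n ≠ 0` this frequency has modulus at
least `2πp - pπ ≥ mπ`, so only `n = 0` survives. Splitting the sum of `g` over the integers by
residues mod p gives the `S_k`.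

The hypergeometric form of `S_k` is a termwise identity: Gamma values at arguments shifted by n are
shifted factorials, and each reflected factor contributes a sign `(-1)^n`. -/

/-! ### Shifts of 1/Γ and the terms of the bilateral series. -/

theorem Complex.inv_Gamma_eq_prod_mul (s : ℂ) (n : ℕ) :
    (Complex.Gamma s)⁻¹ = (∏ i ∈ Finset.range n, (s + i)) * (Complex.Gamma (s + n))⁻¹ := by
  induction n with
  | zero => simp
  | succ n ih =>
    rw [ih, Finset.prod_range_succ, Complex.one_div_Gamma_eq_self_mul_one_div_Gamma_add_one (s + n),
      Nat.cast_succ, add_assoc s, mul_assoc]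

/-- Working with reciprocals allows `d + n` to be a pole of Γ: both sides are then 0, by the default
values. -/
theorem inv_Gamma_add_intCast {d : ℂ} (hd : ∀ k : ℕ, d ≠ -k) (n : ℤ) :
    (Complex.Gamma (d + n))⁻¹ = (Complex.Gamma d)⁻¹ * (shiftedFactorial d n)⁻¹ := by
  cases n with
  | ofNat n =>
    have hP : ∏ i ∈ Finset.range n, (d + i) ≠ 0 :=
      Finset.prod_ne_zero_iff.2 fun i _ h => hd i (eq_neg_of_add_eq_zero_left h)
    simp only [shiftedFactorial, Int.ofNat_eq_natCast, Int.cast_natCast]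
    rw [Complex.inv_Gamma_eq_prod_mul d n]
    field_simp
  | negSucc n =>
    rw [shiftedFactorial, inv_inv, Complex.inv_Gamma_eq_prod_mul _ (n + 1), mul_comm]
    congr 1
    · rw [Int.cast_negSucc]
      congr 2
      ring
    · rw [← Finset.prod_range_reflect]
      refine Finset.prod_congr rfl fun i hi => ?_
      have hi' : i ≤ n := Nat.lt_succ_iff.mp (Finset.mem_range.mp hi)
      rw [Int.cast_negSucc, show n + 1 - 1 - i = n - i by omega, Nat.cast_sub hi']
      push_cast
      ring

/-- Reversing the sign of each linear factor. This turns the factors `Γ(1 + b_j - x)` into numerator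
parameters and is the source of `(-1)^m` in the argument of the series. -/
theorem inv_shiftedFactorial_neg (d : ℂ) (n : ℤ) :
    (shiftedFactorial d (-n))⁻¹ = (-1) ^ n * shiftedFactorial (1 - d) n := by
  have key : ∀ (x y : ℕ → ℂ) (N : ℕ), (∀ i, x i = -y i) →
      ∏ i ∈ Finset.range N, x i = (-1) ^ N * ∏ i ∈ Finset.range N, y i := by
    intro x y N h
    rw [Finset.prod_congr rfl fun i _ => h i, Finset.prod_neg, Finset.card_range]
  cases n with
  | ofNat n =>
    cases n with
    | zero => simp [shiftedFactorial]
    | succ n =>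
      rw [show -Int.ofNat (n + 1) = Int.negSucc n from rfl]
      simp only [shiftedFactorial, inv_inv]
      rw [Int.ofNat_eq_natCast, zpow_natCast]
      exact key _ _ _ fun i => by ring
  | negSucc n =>
    rw [Int.neg_negSucc, shiftedFactorial, zpow_negSucc, ← Int.ofNat_eq_natCast, shiftedFactorial,
      ← mul_inv, key _ (fun i : ℕ => 1 - d - (i + 1)) _ fun i => by ring]

/-- Allows division by `C_k`, so that summability passes from `S_k` to the bilateral series. -/
theorem coeffC_ne_zero {m : ℕ} {a b : Fin m → ℂ} {p : ℕ} {k : ℤ}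
    (h : BilateralWellDefined (fun j => -b j + (k : ℂ) / p) (fun j => a j + 1 + (k : ℂ) / p)) :
    coeffC a b p k ≠ 0 := by
  refine one_div_ne_zero (Finset.prod_ne_zero_iff.2 fun j _ => mul_ne_zero ?_ ?_)
  · exact Complex.Gamma_ne_zero (h.2 j)
  · exact Complex.Gamma_ne_zero fun n hn => h.1 j n (by linear_combination -hn)

theorem riemannTerm_eq_bilateralTerm {m : ℕ} {a b : Fin m → ℂ} {p : ℕ} (t : ℝ) {k : ℤ}
    (h : BilateralWellDefined (fun j => -b j + (k : ℂ) / p) (fun j => a j + 1 + (k : ℂ) / p))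
    (n : ℤ) :
    riemannTerm a b p t k n =
      coeffC a b p k * Complex.exp (-Complex.I * ((k : ℂ) / p) * t) *
        bilateralTerm (fun j => -b j + (k : ℂ) / p) (fun j => a j + 1 + (k : ℂ) / p)
          ((-1) ^ m * Complex.exp (-Complex.I * t)) n := by
  set κ : ℂ := (k : ℂ) / p with hκ
  have hexp : Complex.exp (-Complex.I * ((n : ℂ) + κ) * t) =
      Complex.exp (-Complex.I * κ * t) * Complex.exp (-Complex.I * t) ^ n := by
    rw [← Complex.exp_int_mul, ← Complex.exp_add]
    congr 1
    ring
  have hfac : ∀ j, 1 / (Complex.Gamma (1 + a j + (n + κ)) * Complex.Gamma (1 + b j - (n + κ))) =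
      (Complex.Gamma (a j + 1 + κ) * Complex.Gamma (b j + 1 - κ))⁻¹ *
        ((-1) ^ n * (shiftedFactorial (-b j + κ) n * (shiftedFactorial (a j + 1 + κ) n)⁻¹)) := by
    intro j
    have h1 := inv_Gamma_add_intCast (h.2 j) n
    have h2 := inv_Gamma_add_intCast (d := b j + 1 - κ)
      (fun i hi => h.1 j i (by linear_combination -hi)) (-n)
    rw [inv_shiftedFactorial_neg] at h2
    rw [one_div, mul_inv, show 1 + a j + (n + κ) = a j + 1 + κ + n by ring, h1,
      show 1 + b j - (n + κ) = b j + 1 - κ + ((-n : ℤ) : ℂ) by push_cast; ring, h2,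
      show 1 - (b j + 1 - κ) = -b j + κ by ring, mul_inv]
    ring
  rw [riemannTerm, gammaProd, coeffC, bilateralTerm, ← hκ, hexp, Finset.prod_congr rfl fun j _ => hfac j,
    Finset.prod_mul_distrib, Finset.prod_mul_distrib, Finset.prod_mul_distrib, Finset.prod_const,
    Finset.card_univ, Fintype.card_fin, Finset.prod_inv_distrib, Finset.prod_inv_distrib, mul_zpow,
    ← zpow_natCast ((-1 : ℂ) ^ n), ← zpow_natCast (-1 : ℂ) m, ← zpow_mul, ← zpow_mul, mul_comm n]
  ring

/-! ### One Gamma factor: functional equations and its Beta integral. -/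

/-- The entire function `z ↦ 1 / (Γ(1 + a + z) Γ(1 + b - z))`. -/
noncomputable def gammaFactor (a b z : ℂ) : ℂ :=
  1 / (Complex.Gamma (1 + a + z) * Complex.Gamma (1 + b - z))

theorem gammaFactor_neg (a b z : ℂ) : gammaFactor a b (-z) = gammaFactor b a z := by
  rw [gammaFactor, gammaFactor, sub_neg_eq_add, mul_comm, ← sub_eq_add_neg]

theorem differentiable_gammaFactor (a b : ℂ) : Differentiable ℂ (gammaFactor a b) := by
  have h1 : Differentiable ℂ fun z => (Complex.Gamma (1 + a + z))⁻¹ :=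
    Complex.differentiable_one_div_Gamma.comp (by fun_prop : Differentiable ℂ fun z => 1 + a + z)
  have h2 : Differentiable ℂ fun z => (Complex.Gamma (1 + b - z))⁻¹ :=
    Complex.differentiable_one_div_Gamma.comp (by fun_prop : Differentiable ℂ fun z => 1 + b - z)
  have h : gammaFactor a b =
      (fun z => (Complex.Gamma (1 + a + z))⁻¹) * fun z => (Complex.Gamma (1 + b - z))⁻¹ := by
    ext z
    simp only [gammaFactor, one_div, mul_inv, Pi.mul_apply]
  exact h ▸ h1.mul h2

theorem gammaFactor_eq_mul_left (a b z : ℂ) :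
    gammaFactor a b z = (1 + a + z) * gammaFactor (a + 1) b z := by
  simp only [gammaFactor, one_div, mul_inv]
  rw [Complex.one_div_Gamma_eq_self_mul_one_div_Gamma_add_one (1 + a + z),
    show 1 + (a + 1) + z = 1 + a + z + 1 by ring]
  ring

theorem gammaFactor_eq_mul_right (a b z : ℂ) :
    gammaFactor a b z = (1 + b - z) * gammaFactor a (b + 1) z := by
  have h := gammaFactor_eq_mul_left b a (-z)
  rwa [gammaFactor_neg, gammaFactor_neg, ← sub_eq_add_neg] at h

/-- Since `1 - u ≤ e^(-u)`, the Beta integrand is dominated by a Gamma integrand. The bound does not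
involve `Im s`, which makes it uniform on vertical lines and replaces Stirling's formula. -/
theorem Complex.norm_betaIntegral_le {s c : ℂ} (hs : 1 < s.re) (hc : 0 < c.re) :
    ‖Complex.betaIntegral s c‖ ≤ (s.re - 1) ^ (-c.re) * Real.Gamma c.re := by
  have hr : 0 < s.re - 1 := sub_pos.2 hs
  have hint : MeasureTheory.IntegrableOn
      (fun u : ℝ => u ^ (c.re - 1) * Real.exp (-((s.re - 1) * u))) (Set.Ioi 0) := by
    have := integrableOn_rpow_mul_exp_neg_mul_rpow (s := c.re - 1) (p := 1) (b := s.re - 1)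
      (by linarith) one_pos hr
    simpa only [Real.rpow_one, neg_mul] using this
  have hpt : ∀ u ∈ Set.Ioc (0 : ℝ) 1, ‖(u : ℂ) ^ (c - 1) * (1 - (u : ℂ)) ^ (s - 1)‖ ≤
      u ^ (c.re - 1) * Real.exp (-((s.re - 1) * u)) := by
    intro u hu
    have h1 : ‖(u : ℂ) ^ (c - 1)‖ = u ^ (c.re - 1) := by
      rw [Complex.norm_cpow_eq_rpow_re_of_pos hu.1]; simp
    have h2 : ‖(1 - (u : ℂ)) ^ (s - 1)‖ = (1 - u) ^ (s.re - 1) := by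
      rw [show (1 - (u : ℂ)) = ((1 - u : ℝ) : ℂ) by push_cast; rfl,
        Complex.norm_cpow_eq_rpow_re_of_nonneg (by linarith [hu.2]) (by simpa using hr.ne')]
      simp
    rw [norm_mul, h1, h2]
    gcongr
    · exact Real.rpow_nonneg hu.1.le _
    · calc (1 - u) ^ (s.re - 1) ≤ (Real.exp (-u)) ^ (s.re - 1) := by
            gcongr
            · linarith [hu.2]
            · linarith [Real.add_one_le_exp (-u)]
        _ = _ := by rw [← Real.exp_mul]; congr 1; ring
  rw [← Complex.betaIntegral_symm, Complex.betaIntegral,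
    intervalIntegral.integral_of_le zero_le_one]
  calc _ ≤ ∫ u in Set.Ioc (0 : ℝ) 1, u ^ (c.re - 1) * Real.exp (-((s.re - 1) * u)) := by
        refine MeasureTheory.norm_integral_le_of_norm_le
          (hint.mono_set Set.Ioc_subset_Ioi_self) ?_
        exact (MeasureTheory.ae_restrict_iff' measurableSet_Ioc).2 (.of_forall hpt)
    _ ≤ ∫ u in Set.Ioi (0 : ℝ), u ^ (c.re - 1) * Real.exp (-((s.re - 1) * u)) := by
        refine MeasureTheory.setIntegral_mono_set hint ?_
          (Filter.Eventually.of_forall Set.Ioc_subset_Ioi_self)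
        refine (MeasureTheory.ae_restrict_iff' measurableSet_Ioi).2 (.of_forall fun u hu => ?_)
        exact mul_nonneg (Real.rpow_nonneg (le_of_lt hu) _) (Real.exp_pos _).le
    _ = _ := by
        rw [Real.integral_rpow_mul_exp_neg_mul_Ioi hc hr, one_div, Real.inv_rpow hr.le,
          Real.rpow_neg hr.le]

theorem Complex.norm_sin_le_exp (w : ℂ) : ‖Complex.sin w‖ ≤ Real.exp |w.im| := by
  have h1 : ‖Complex.exp (-w * Complex.I)‖ ≤ Real.exp |w.im| := by
    rw [Complex.norm_exp]
    simpa using le_abs_self w.im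
  have h2 : ‖Complex.exp (w * Complex.I)‖ ≤ Real.exp |w.im| := by
    rw [Complex.norm_exp]
    simpa using neg_le_abs w.im
  rw [Complex.sin, norm_div, norm_mul, Complex.norm_I, Complex.norm_ofNat, mul_one]
  linarith [norm_sub_le (Complex.exp (-w * Complex.I)) (Complex.exp (w * Complex.I))]

/-- Reflection replaces `1/Γ(1 + b - z)` by `Γ(z - b) sin(π(z - b))/π`, and the quotient `Γ(z -
b)/Γ(1 + a + z)` is a Beta value. The sine carries the growth `e^(π|y|)`, the Beta integral the
decay in x. -/
theorem gammaFactor_eq_betaIntegral {a b z : ℂ} (hs : 0 < (z - b).re) (hc : 0 < (a + b + 1).re) :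
    gammaFactor a b z = Complex.betaIntegral (z - b) (a + b + 1) *
      (Complex.Gamma (a + b + 1))⁻¹ * (Complex.sin (Real.pi * (z - b)) / Real.pi) := by
  have hG := Complex.Gamma_mul_Gamma_eq_betaIntegral hs hc
  rw [show z - b + (a + b + 1) = 1 + a + z by ring] at hG
  have hR := Complex.Gamma_mul_Gamma_one_sub (z - b)
  rw [show 1 - (z - b) = 1 + b - z by ring] at hR
  have n1 := Complex.Gamma_ne_zero_of_re_pos hs
  have n2 := Complex.Gamma_ne_zero_of_re_pos hc
  have n3 : Complex.Gamma (1 + a + z) ≠ 0 := by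
    refine Complex.Gamma_ne_zero_of_re_pos ?_
    have : (1 + a + z).re = (z - b).re + (a + b + 1).re := by simp; ring
    linarith
  have hpi : (Real.pi : ℂ) ≠ 0 := by exact_mod_cast Real.pi_ne_zero
  have hinv : (Complex.Gamma (1 + b - z))⁻¹ =
      Complex.Gamma (z - b) * (Complex.sin (Real.pi * (z - b)) / Real.pi) := by
    rw [← inv_div, ← hR, mul_inv, ← mul_assoc, mul_inv_cancel₀ n1, one_mul]
  have hbeta : Complex.betaIntegral (z - b) (a + b + 1) =
      Complex.Gamma (z - b) * Complex.Gamma (a + b + 1) * (Complex.Gamma (1 + a + z))⁻¹ := by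
    rw [hG]; field_simp
  rw [gammaFactor, one_div, mul_inv, hinv, hbeta]
  field_simp

/-! ### Growth of the integrand on the whole plane. -/

/-- The majorant `(1 + |x|)^(-σ) (1 + |y|)^K e^{r |y|}` at `z = x + iy`. -/
noncomputable def stripMajorant (σ : ℝ) (K : ℕ) (r : ℝ) (z : ℂ) : ℝ :=
  (1 + |z.re|) ^ (-σ) * (1 + |z.im|) ^ K * Real.exp (r * |z.im|)

theorem stripMajorant_pos (σ : ℝ) (K : ℕ) (r : ℝ) (z : ℂ) : 0 < stripMajorant σ K r z := by
  unfold stripMajorant; positivity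

theorem continuous_stripMajorant (σ : ℝ) (K : ℕ) (r : ℝ) : Continuous (stripMajorant σ K r) := by
  unfold stripMajorant
  refine ((Continuous.rpow_const (by fun_prop) fun z => Or.inl ?_).mul (by fun_prop)).mul
    (by fun_prop)
  positivity

theorem stripMajorant_mul (σ σ' : ℝ) (K K' : ℕ) (r r' : ℝ) (z : ℂ) :
    stripMajorant σ K r z * stripMajorant σ' K' r' z =
      stripMajorant (σ + σ') (K + K') (r + r') z := by
  unfold stripMajorant
  rw [neg_add, Real.rpow_add (by positivity), pow_add, add_mul, Real.exp_add]
  ring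

/-- `f` is bounded by a multiple of `stripMajorant σ K r` on `s` for some `K`. -/
def StripBound (f : ℂ → ℂ) (σ r : ℝ) (s : Set ℂ) : Prop :=
  ∃ C : ℝ, ∃ K : ℕ, 0 ≤ C ∧ ∀ z ∈ s, ‖f z‖ ≤ C * stripMajorant σ K r z

theorem StripBound.mul {f g : ℂ → ℂ} {σ σ' r r' : ℝ} {s : Set ℂ} (hf : StripBound f σ r s)
    (hg : StripBound g σ' r' s) : StripBound (fun z => f z * g z) (σ + σ') (r + r') s := by
  obtain ⟨C, K, hC, hf⟩ := hf
  obtain ⟨C', K', hC', hg⟩ := hg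
  refine ⟨C * C', K + K', mul_nonneg hC hC', fun z hz => ?_⟩
  rw [← stripMajorant_mul, norm_mul, mul_mul_mul_comm]
  exact mul_le_mul (hf z hz) (hg z hz) (norm_nonneg _) ((norm_nonneg _).trans (hf z hz))

theorem StripBound.union {f : ℂ → ℂ} {σ r : ℝ} {s s' : Set ℂ} (h : StripBound f σ r s)
    (h' : StripBound f σ r s') : StripBound f σ r (s ∪ s') := by
  obtain ⟨C, K, hC, h⟩ := h
  obtain ⟨C', K', hC', h'⟩ := h'
  have mono : ∀ (K K' : ℕ) z, K ≤ K' → stripMajorant σ K r z ≤ stripMajorant σ K' r z := by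
    intro K K' z hK
    unfold stripMajorant
    gcongr
    linarith [abs_nonneg z.im]
  refine ⟨max C C', max K K', hC.trans (le_max_left _ _), fun z hz => ?_⟩
  rcases hz with hz | hz
  · exact (h z hz).trans (mul_le_mul (le_max_left _ _) (mono _ _ z (le_max_left _ _))
      (stripMajorant_pos ..).le (hC.trans (le_max_left _ _)))
  · exact (h' z hz).trans (mul_le_mul (le_max_right _ _) (mono _ _ z (le_max_right _ _))
      (stripMajorant_pos ..).le (hC.trans (le_max_left _ _)))

theorem StripBound.of_isCompact {f : ℂ → ℂ} (hf : Continuous f) (σ r : ℝ) {s : Set ℂ}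
    (hs : IsCompact s) : StripBound f σ r s := by
  have hcont : Continuous fun z => ‖f z‖ / stripMajorant σ 0 r z :=
    hf.norm.div (continuous_stripMajorant ..) fun z => (stripMajorant_pos ..).ne'
  obtain ⟨C, hC⟩ := (hs.image hcont).bddAbove
  refine ⟨max C 0, 0, le_max_right _ _, fun z hz => ?_⟩
  rw [← div_le_iff₀ (stripMajorant_pos ..)]
  exact (hC (Set.mem_image_of_mem _ hz)).trans (le_max_left _ _)

theorem stripBound_add_const (w : ℂ) (s : Set ℂ) : StripBound (fun z => w + z) (-1) 0 s := by
  refine ⟨1 + ‖w‖, 1, by positivity, fun z _ => ?_⟩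
  unfold stripMajorant
  rw [neg_neg, Real.rpow_one, pow_one, zero_mul, Real.exp_zero, mul_one]
  have := norm_add_le w z
  have := Complex.norm_le_abs_re_add_abs_im z
  nlinarith [norm_nonneg w, abs_nonneg z.re, abs_nonneg z.im,
    mul_nonneg (abs_nonneg z.re) (abs_nonneg z.im),
    mul_nonneg (norm_nonneg w) (abs_nonneg z.re), mul_nonneg (norm_nonneg w) (abs_nonneg z.im),
    mul_nonneg (norm_nonneg w) (mul_nonneg (abs_nonneg z.re) (abs_nonneg z.im))]

theorem stripBound_inv_const_sub (w : ℂ) {s : Set ℂ} (hs : ∀ z ∈ s, 1 ≤ ‖w - z‖) :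
    StripBound (fun z => (w - z)⁻¹) 1 0 s := by
  refine ⟨2 + ‖w‖, 0, by positivity, fun z hz => ?_⟩
  have h1 := hs z hz
  unfold stripMajorant
  rw [Real.rpow_neg_one, pow_zero, zero_mul, Real.exp_zero, mul_one, mul_one, norm_inv,
    ← div_eq_mul_inv, le_div_iff₀ (by positivity), inv_mul_le_iff₀ (by linarith)]
  have h2 := Complex.abs_re_le_norm z
  have h3 := norm_sub_le w (w - z)
  rw [sub_sub_cancel] at h3
  nlinarith [norm_nonneg w]

/-- The closed right half-plane. -/
def rightHalfPlane : Set ℂ := {z | 0 ≤ z.re}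

theorem stripBound_gammaFactor_of_re_le {a b : ℂ} (hb : b.re ≤ -2) (hc : 0 < (a + b + 1).re) :
    StripBound (gammaFactor a b) (a + b + 1).re Real.pi rightHalfPlane := by
  have hΓ := Real.Gamma_pos_of_pos hc
  refine ⟨Real.Gamma (a + b + 1).re * ‖(Complex.Gamma (a + b + 1))⁻¹‖ *
    (Real.exp (Real.pi * |b.im|) / Real.pi), 0, ?_, fun z (hz : 0 ≤ z.re) => ?_⟩
  · have := Real.pi_pos
    positivity
  have hs : 1 < (z - b).re := by rw [Complex.sub_re]; linarith
  have h1 := Complex.norm_betaIntegral_le hs hc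
  -- `Re b ≤ -2` is what gives `Re (z - b) - 1 ≥ 1 + Re z`.
  have h2 : ((z - b).re - 1) ^ (-(a + b + 1).re) ≤ (1 + |z.re|) ^ (-(a + b + 1).re) := by
    refine Real.rpow_le_rpow_of_nonpos (by positivity) ?_ (by linarith)
    rw [abs_of_nonneg hz, Complex.sub_re]
    linarith
  have h3 : ‖Complex.sin (Real.pi * (z - b)) / Real.pi‖ ≤
      Real.exp (Real.pi * |b.im|) * Real.exp (Real.pi * |z.im|) / Real.pi := by
    rw [norm_div, Complex.norm_real, Real.norm_of_nonneg Real.pi_pos.le]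
    have := Real.pi_pos
    gcongr
    refine (Complex.norm_sin_le_exp _).trans ?_
    rw [← Real.exp_add, Real.exp_le_exp, Complex.im_ofReal_mul, abs_mul,
      abs_of_pos Real.pi_pos, ← mul_add, Complex.sub_im, add_comm]
    gcongr
    exact abs_sub _ _
  rw [gammaFactor_eq_betaIntegral (by linarith) hc, norm_mul, norm_mul]
  unfold stripMajorant
  calc _ ≤ ((1 + |z.re|) ^ (-(a + b + 1).re) * Real.Gamma (a + b + 1).re) *
        ‖(Complex.Gamma (a + b + 1))⁻¹‖ *
        (Real.exp (Real.pi * |b.im|) * Real.exp (Real.pi * |z.im|) / Real.pi) := by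
        gcongr
        exact h1.trans (by gcongr)
    _ = _ := by ring

theorem StripBound.gammaFactor_left {a b : ℂ} {s : Set ℂ}
    (h : StripBound (gammaFactor (a + 1) b) (a + 1 + b + 1).re Real.pi s) :
    StripBound (gammaFactor a b) (a + b + 1).re Real.pi s := by
  have := (stripBound_add_const (1 + a) s).mul h
  simp only [← gammaFactor_eq_mul_left] at this
  convert this using 1
  · simp; ring
  · ring

/-- Raising b divides by `1 + b - z`. Outside the unit disc about its zero the quotient gains one
power of decay; on the disc an entire function is bounded by compactness. -/
theorem StripBound.gammaFactor_right {a b : ℂ} {s : Set ℂ}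
    (h : StripBound (gammaFactor a b) (a + b + 1).re Real.pi s) :
    StripBound (gammaFactor a (b + 1)) (a + (b + 1) + 1).re Real.pi s := by
  set w := 1 + b
  obtain ⟨C, K, hC, hK⟩ := h
  have h1 : StripBound (gammaFactor a (b + 1)) (a + (b + 1) + 1).re Real.pi
      (s ∩ {z | 1 ≤ ‖w - z‖}) := by
    obtain ⟨C', K', hC', hK'⟩ := StripBound.mul
      (stripBound_inv_const_sub w (s := s ∩ {z | 1 ≤ ‖w - z‖}) fun z hz => hz.2)
      ⟨C, K, hC, fun z hz => hK z hz.1⟩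
    refine ⟨C', K', hC', fun z hz => ?_⟩
    have hne : w - z ≠ 0 := norm_pos_iff.1 (one_pos.trans_le hz.2)
    have := hK' z hz
    simp only [] at this
    rw [gammaFactor_eq_mul_right, inv_mul_cancel_left₀ hne] at this
    convert this using 3
    · simp; ring
    · ring
  have h2 : StripBound (gammaFactor a (b + 1)) (a + (b + 1) + 1).re Real.pi
      (Metric.closedBall w 1) :=
    .of_isCompact (differentiable_gammaFactor _ _).continuous _ _ (isCompact_closedBall _ _)
  obtain ⟨C', K', hC', hK'⟩ := h1.union h2
  refine ⟨C', K', hC', fun z hz => hK' z ?_⟩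
  rcases le_total 1 ‖w - z‖ with h | h
  · exact Or.inl ⟨hz, h⟩
  · exact Or.inr (by rwa [Metric.mem_closedBall, dist_comm, dist_eq_norm])

theorem stripBound_gammaFactor_rightHalfPlane (a b : ℂ) :
    StripBound (gammaFactor a b) (a + b + 1).re Real.pi rightHalfPlane := by
  have hL : ∀ (n : ℕ) (a b : ℂ),
      StripBound (gammaFactor (a + n) b) (a + n + b + 1).re Real.pi rightHalfPlane →
      StripBound (gammaFactor a b) (a + b + 1).re Real.pi rightHalfPlane := by
    intro n
    induction n with
    | zero => simp
    | succ n ih =>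
      intro a b h
      refine ih a b (StripBound.gammaFactor_left ?_)
      rwa [Nat.cast_succ, ← add_assoc] at h
  have hR : ∀ (n : ℕ) (a b : ℂ),
      StripBound (gammaFactor a b) (a + b + 1).re Real.pi rightHalfPlane →
      StripBound (gammaFactor a (b + n)) (a + (b + n) + 1).re Real.pi rightHalfPlane := by
    intro n
    induction n with
    | zero => simp
    | succ n ih =>
      intro a b h
      rw [Nat.cast_succ, ← add_assoc]
      exact (ih a b h).gammaFactor_right
  -- Lower b by n until `Re b ≤ -2`, then raise a by k until the Beta parameter has positive real
  -- part; `hL` and `hR` undo both shifts.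
  obtain ⟨n, hn⟩ := exists_nat_ge (b.re + 2)
  obtain ⟨k, hk⟩ := exists_nat_gt (-(a + (b - n) + 1).re)
  have h := stripBound_gammaFactor_of_re_le (a := a + k) (b := b - n)
    (by simp; linarith) (by simp at hk ⊢; linarith)
  simpa using hR n _ _ (hL k _ _ h)

theorem stripBound_gammaFactor (a b : ℂ) :
    StripBound (gammaFactor a b) (a + b + 1).re Real.pi Set.univ := by
  have h2 : StripBound (gammaFactor a b) (a + b + 1).re Real.pi {z | z.re ≤ 0} := by
    obtain ⟨C, K, hC, h⟩ := stripBound_gammaFactor_rightHalfPlane b a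
    refine ⟨C, K, hC, fun z (hz : z.re ≤ 0) => ?_⟩
    have := h (-z) (show 0 ≤ (-z).re by simpa)
    rw [gammaFactor_neg] at this
    simpa [stripMajorant, add_comm b.re] using this
  obtain ⟨C, K, hC, h⟩ := (stripBound_gammaFactor_rightHalfPlane a b).union h2
  exact ⟨C, K, hC, fun z _ => h z (le_total 0 z.re)⟩

theorem stripBound_gammaProd {m : ℕ} (a b : Fin m → ℂ) :
    StripBound (gammaProd a b) (∑ j, (a j + b j + 1).re) (m * Real.pi) Set.univ := by
  have key : ∀ s : Finset (Fin m), StripBound (fun z => ∏ j ∈ s, gammaFactor (a j) (b j) z)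
      (∑ j ∈ s, (a j + b j + 1).re) (s.card * Real.pi) Set.univ := by
    classical
    intro s
    induction s using Finset.induction_on with
    | empty => exact ⟨1, 0, zero_le_one, fun z _ => by simp [stripMajorant]⟩
    | insert i s hi ih =>
      simp only [Finset.prod_insert hi, Finset.sum_insert hi, Finset.card_insert_of_notMem hi]
      convert (stripBound_gammaFactor (a i) (b i)).mul ih using 1
      push_cast
      ring
  have h := key Finset.univ
  rwa [Finset.card_univ, Fintype.card_fin] at h

theorem differentiable_gammaProd {m : ℕ} (a b : Fin m → ℂ) : Differentiable ℂ (gammaProd a b) :=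
  Differentiable.fun_finsetProd fun j _ => differentiable_gammaFactor (a j) (b j)

theorem gammaProd_neg {m : ℕ} (a b : Fin m → ℂ) (z : ℂ) :
    gammaProd a b (-z) = gammaProd b a z :=
  Finset.prod_congr rfl fun j _ => gammaFactor_neg (a j) (b j) z

/-! ### Shifting the line of integration. -/

theorem integrable_one_add_abs_rpow_neg {σ : ℝ} (hσ : 1 < σ) :
    MeasureTheory.Integrable fun x : ℝ => (1 + |x|) ^ (-σ) := by
  simpa using integrable_one_add_norm (E := ℝ) (μ := MeasureTheory.volume) (r := σ) (by simpa)

theorem tendsto_one_add_rpow_neg {σ : ℝ} (hσ : 0 < σ) :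
    Filter.Tendsto (fun T : ℝ => (1 + T) ^ (-σ)) Filter.atTop (nhds 0) :=
  (tendsto_rpow_neg_atTop hσ).comp (Filter.tendsto_atTop_add_const_left _ 1 Filter.tendsto_id)

/-- Shifting the line of integration of an entire function that decays on the strip between the
two lines. -/
theorem integral_eq_integral_add_mul_I {F : ℂ → ℂ} (hF : Differentiable ℂ F) {σ C Y : ℝ}
    (hσ : 1 < σ) (h : ∀ z : ℂ, z.im ∈ Set.uIcc 0 Y → ‖F z‖ ≤ C * (1 + |z.re|) ^ (-σ)) :
    ∫ x : ℝ, F x = ∫ x : ℝ, F (x + Y * Complex.I) := by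
  have hint : ∀ y ∈ Set.uIcc 0 Y, MeasureTheory.Integrable fun x : ℝ => F (x + y * Complex.I) := by
    intro y hy
    refine ((integrable_one_add_abs_rpow_neg hσ).const_mul C).mono'
      (hF.continuous.comp (by fun_prop)).aestronglyMeasurable (.of_forall fun x => ?_)
    simpa using h (x + y * Complex.I) (by simpa using hy)
  have lim : ∀ y ∈ Set.uIcc 0 Y, Filter.Tendsto (fun T : ℝ => ∫ x in -T..T, F (x + y * Complex.I))
      Filter.atTop (nhds (∫ x : ℝ, F (x + y * Complex.I))) := fun y hy =>
    MeasureTheory.intervalIntegral_tendsto_integral (hint y hy) Filter.tendsto_neg_atTop_atBot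
      Filter.tendsto_id
  -- The vertical sides of the rectangle have fixed length `|Y|`, so they vanish as `T → ∞`.
  have hside : ∀ s T : ℝ, |s| = T →
      ‖∫ y in (0 : ℝ)..Y, F (s + y * Complex.I)‖ ≤ C * (1 + T) ^ (-σ) * |Y| := by
    intro s T hs
    have := intervalIntegral.norm_integral_le_of_norm_le_const (a := (0 : ℝ)) (b := Y)
      (f := fun y : ℝ => F (s + y * Complex.I)) (C := C * (1 + T) ^ (-σ)) fun y hy => by
        simpa [hs] using h (s + y * Complex.I) (by simpa using Set.uIoc_subset_uIcc hy)
    simpa using this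
  have hdiff : Filter.Tendsto (fun T : ℝ => (∫ x in -T..T, F (x + (0 : ℝ) * Complex.I)) -
      ∫ x in -T..T, F (x + Y * Complex.I)) Filter.atTop (nhds 0) := by
    refine squeeze_zero_norm' (a := fun T : ℝ => 2 * (C * (1 + T) ^ (-σ) * |Y|)) ?_ ?_
    · filter_upwards [Filter.eventually_ge_atTop 0] with T hT
      have hrect := Complex.integral_boundary_rect_eq_zero_of_differentiableOn F
        (-T : ℝ) (T + Y * Complex.I) hF.differentiableOn
      simp only [Complex.ofReal_re, Complex.ofReal_im, Complex.add_re, Complex.add_im,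
        Complex.mul_re, Complex.mul_im, Complex.I_re, Complex.I_im, mul_zero, mul_one, sub_zero,
        add_zero, zero_add, smul_eq_mul] at hrect
      have h1 := hside T T (abs_of_nonneg hT)
      have h2 := hside (-T) T (by rw [abs_neg, abs_of_nonneg hT])
      have e := sub_eq_zero.1 hrect
      rw [eq_sub_of_add_eq e, ← mul_sub, norm_mul, Complex.norm_I, one_mul]
      refine (norm_sub_le _ _).trans ?_
      linarith
    · have := (((tendsto_one_add_rpow_neg (one_pos.trans hσ)).const_mul C).mul_const |Y|).const_mul 2
      simpa using this
  have := tendsto_nhds_unique hdiff ((lim 0 Set.left_mem_uIcc).sub (lim Y Set.right_mem_uIcc))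
  simpa using (sub_eq_zero.1 this.symm)

/-! ### Vanishing of the Fourier integral outside the band. -/

section

variable {m : ℕ} {a b : Fin m → ℂ} (hab : 1 < ∑ j, (a j + b j + 1).re)

theorem norm_exp_neg_I_mul (z : ℂ) (τ : ℝ) :
    ‖Complex.exp (-Complex.I * z * τ)‖ = Real.exp (τ * z.im) := by
  rw [Complex.norm_exp]
  simp [mul_comm]

theorem norm_exp_neg_I_mul_ofReal (x τ : ℝ) : ‖Complex.exp (-Complex.I * x * τ)‖ = 1 := by
  rw [norm_exp_neg_I_mul, Complex.ofReal_im, mul_zero, Real.exp_zero]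

theorem exists_norm_gammaProd_ofReal_le (a b : Fin m → ℂ) :
    ∃ C : ℝ, ∀ x : ℝ, ‖gammaProd a b x‖ ≤ C * (1 + |x|) ^ (-∑ j, (a j + b j + 1).re) := by
  obtain ⟨C, K, -, h⟩ := stripBound_gammaProd a b
  exact ⟨C, fun x => by simpa [stripMajorant] using h x trivial⟩

theorem continuous_gammaProd_mul_exp (a b : Fin m → ℂ) (τ : ℝ) :
    Continuous fun x : ℝ => gammaProd a b x * Complex.exp (-Complex.I * x * τ) :=
  ((differentiable_gammaProd a b).continuous.comp Complex.continuous_ofReal).mul (by fun_prop)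

include hab

theorem integrable_gammaProd : MeasureTheory.Integrable fun x : ℝ => gammaProd a b x := by
  obtain ⟨C, h⟩ := exists_norm_gammaProd_ofReal_le a b
  exact ((integrable_one_add_abs_rpow_neg hab).const_mul C).mono'
    ((differentiable_gammaProd a b).continuous.comp
      Complex.continuous_ofReal).aestronglyMeasurable (.of_forall h)

theorem integrable_gammaProd_mul_exp (τ : ℝ) :
    MeasureTheory.Integrable
      fun x : ℝ => gammaProd a b x * Complex.exp (-Complex.I * x * τ) :=
  (integrable_gammaProd hab).norm.mono' (continuous_gammaProd_mul_exp a b τ).aestronglyMeasurable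
    (.of_forall fun x => by rw [norm_mul, norm_exp_neg_I_mul_ofReal, mul_one])

theorem continuous_integral_gammaProd_mul_exp :
    Continuous fun τ : ℝ => ∫ x : ℝ, gammaProd a b x * Complex.exp (-Complex.I * x * τ) := by
  refine MeasureTheory.continuous_of_dominated
    (fun τ => (continuous_gammaProd_mul_exp a b τ).aestronglyMeasurable)
    (fun τ => .of_forall fun x => ?_) (integrable_gammaProd hab).norm
    (.of_forall fun x => by fun_prop)
  rw [norm_mul, norm_exp_neg_I_mul_ofReal, mul_one]

/-- The easy Paley–Wiener argument: on the line `Im z = -Y` the exponential contributes `e^(-τY)`,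
which beats `(1 + Y)^K e^(mπY)` as `Y → ∞`. -/
theorem integral_gammaProd_mul_exp_eq_zero_of_lt {τ : ℝ} (hτ : m * Real.pi < τ) :
    ∫ x : ℝ, gammaProd a b x * Complex.exp (-Complex.I * x * τ) = 0 := by
  obtain ⟨C, K, hC, h⟩ := stripBound_gammaProd a b
  set σ := ∑ j, (a j + b j + 1).re
  set F : ℂ → ℂ := fun z => gammaProd a b z * Complex.exp (-Complex.I * z * τ)
  have hF : Differentiable ℂ F := (differentiable_gammaProd a b).mul (by fun_prop)
  have hFle : ∀ z : ℂ, z.im ≤ 0 →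
      ‖F z‖ ≤ C * ((1 + |z.im|) ^ K * Real.exp (-(τ - m * Real.pi) * |z.im|)) *
        (1 + |z.re|) ^ (-σ) := by
    intro z hz
    have := mul_le_mul_of_nonneg_right (h z trivial) (Real.exp_pos (τ * z.im)).le
    rw [norm_mul, norm_exp_neg_I_mul]
    refine this.trans_eq ?_
    rw [show -(τ - m * Real.pi) * |z.im| = m * Real.pi * |z.im| + τ * z.im by
      rw [abs_of_nonpos hz]; ring, Real.exp_add, stripMajorant]
    ring
  have hshift : ∀ Y : ℝ, 0 ≤ Y → ‖∫ x : ℝ, F x‖ ≤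
      C * ((1 + Y) ^ K * Real.exp (-(τ - m * Real.pi) * Y)) * ∫ x : ℝ, (1 + |x|) ^ (-σ) := by
    intro Y hY
    -- The constant need only be uniform on the strip, so there the exponential is bounded by 1; its
    -- decay is used only on the line `Im z = -Y`.
    rw [integral_eq_integral_add_mul_I hF (σ := σ) (Y := -Y) (C := C * (1 + Y) ^ K) hab]
    · rw [← MeasureTheory.integral_const_mul]
      refine MeasureTheory.norm_integral_le_of_norm_le
        ((integrable_one_add_abs_rpow_neg hab).const_mul _) (.of_forall fun x => ?_)
      simpa [abs_of_nonneg hY] using hFle (x + (-Y : ℝ) * Complex.I) (by simpa)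
    · intro z hz
      rw [Set.uIcc_of_ge (by linarith)] at hz
      refine (hFle z hz.2).trans ?_
      have habs : |z.im| ≤ Y := abs_le.2 ⟨hz.1, hz.2.trans hY⟩
      have hexp : Real.exp (-(τ - m * Real.pi) * |z.im|) ≤ 1 :=
        Real.exp_le_one_iff.2 (mul_nonpos_of_nonpos_of_nonneg (by linarith) (abs_nonneg _))
      gcongr
      rw [← mul_one ((1 + Y) ^ K)]
      gcongr
  have hlim : Filter.Tendsto (fun Y : ℝ => C * ((1 + Y) ^ K *
      Real.exp (-(τ - m * Real.pi) * Y)) * ∫ x : ℝ, (1 + |x|) ^ (-σ)) Filter.atTop (nhds 0) := by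
    have h1 := (tendsto_rpow_mul_exp_neg_mul_atTop_nhds_zero K (τ - m * Real.pi)
      (sub_pos.2 hτ)).comp (Filter.tendsto_atTop_add_const_left _ 1 Filter.tendsto_id)
    have h2 := ((h1.mul_const (Real.exp (τ - m * Real.pi))).const_mul C).mul_const
      (∫ x : ℝ, (1 + |x|) ^ (-σ))
    simp only [zero_mul, mul_zero] at h2
    refine h2.congr fun Y => ?_
    simp only [Function.comp_apply, id_eq, Real.rpow_natCast]
    rw [mul_assoc ((1 + Y) ^ K), ← Real.exp_add]
    ring_nf
  exact norm_le_zero_iff.1 (ge_of_tendsto hlim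
    ((Filter.eventually_ge_atTop 0).mono fun Y hY => hshift Y hY))

/-- The endpoint `τ = mπ`, needed when `p = m` and `|t| = pπ`, follows by continuity in τ. -/
theorem integral_gammaProd_mul_exp_eq_zero_of_le {τ : ℝ} (hτ : m * Real.pi ≤ τ) :
    ∫ x : ℝ, gammaProd a b x * Complex.exp (-Complex.I * x * τ) = 0 := by
  have h : Set.EqOn (fun τ : ℝ => ∫ x : ℝ, gammaProd a b x * Complex.exp (-Complex.I * x * τ))
      (fun _ => 0) (Set.Ioi (m * Real.pi)) := fun τ hτ =>
    integral_gammaProd_mul_exp_eq_zero_of_lt hab hτ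
  refine h.closure (continuous_integral_gammaProd_mul_exp hab) continuous_const ?_
  rwa [closure_Ioi]

theorem integral_gammaProd_mul_exp_eq_zero {τ : ℝ} (hτ : m * Real.pi ≤ |τ|) :
    ∫ x : ℝ, gammaProd a b x * Complex.exp (-Complex.I * x * τ) = 0 := by
  rcases le_total 0 τ with h | h
  · exact integral_gammaProd_mul_exp_eq_zero_of_le hab (by rwa [abs_of_nonneg h] at hτ)
  -- The substitution `x ↦ -x` exchanges a and b and changes the sign of τ.
  · rw [← MeasureTheory.integral_neg_eq_self]
    have := integral_gammaProd_mul_exp_eq_zero_of_le (a := b) (b := a) (τ := -τ)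
      (by simpa only [add_comm (b _)] using hab) (by rwa [abs_of_nonpos h] at hτ)
    rw [← this]
    refine MeasureTheory.integral_congr_ae (.of_forall fun x => ?_)
    simp only [Complex.ofReal_neg, gammaProd_neg]
    ring_nf

end

/-! ### Poisson summation. -/

section

variable {m : ℕ} {a b : Fin m → ℂ}

/-- The function whose values at the integers are the terms of all the series `S_k(t)`. -/
noncomputable def rescaledIntegrand (a b : Fin m → ℂ) (p : ℕ) (t x : ℝ) : ℂ :=
  gammaProd a b (x / p : ℝ) * Complex.exp (-Complex.I * (x / p : ℝ) * t)

theorem riemannTerm_eq_rescaledIntegrand {p : ℕ} (hp : p ≠ 0) (t : ℝ) (k ℓ : ℤ) :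
    riemannTerm a b p t k ℓ = rescaledIntegrand a b p t ((ℓ * p + k : ℤ) : ℝ) := by
  have hp' : (p : ℂ) ≠ 0 := Nat.cast_ne_zero.2 hp
  have e : (ℓ : ℂ) + (k : ℂ) / p = ((((ℓ * p + k : ℤ) : ℝ) / p : ℝ) : ℂ) := by
    push_cast
    field_simp
  rw [riemannTerm, rescaledIntegrand, e]

theorem continuous_rescaledIntegrand (a b : Fin m → ℂ) (p : ℕ) (t : ℝ) :
    Continuous (rescaledIntegrand a b p t) :=
  (continuous_gammaProd_mul_exp a b t).comp (continuous_id.div_const (p : ℝ))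

variable (hab : 1 < ∑ j, (a j + b j + 1).re)

include hab

theorem isBigO_rescaledIntegrand {p : ℕ} (hp : p ≠ 0) (t : ℝ) :
    rescaledIntegrand a b p t =O[Filter.cocompact ℝ]
      fun x => |x| ^ (-∑ j, (a j + b j + 1).re) := by
  obtain ⟨C, hC⟩ := exists_norm_gammaProd_ofReal_le a b
  set σ := ∑ j, (a j + b j + 1).re
  have hp' : (0 : ℝ) < p := by positivity
  have hC0 : 0 ≤ C := by simpa using (norm_nonneg _).trans (hC 0)
  refine Asymptotics.IsBigO.of_bound (C * (p : ℝ) ^ σ) ?_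
  filter_upwards [(isCompact_singleton (x := (0 : ℝ))).compl_mem_cocompact] with x hx
  have hx0 : 0 < |x| := abs_pos.2 hx
  rw [rescaledIntegrand, norm_mul, norm_exp_neg_I_mul_ofReal, mul_one, mul_assoc,
    Real.norm_of_nonneg (by positivity)]
  refine (hC _).trans (mul_le_mul_of_nonneg_left ?_ hC0)
  calc (1 + |x / p|) ^ (-σ) ≤ (|x| / p) ^ (-σ) := by
        refine Real.rpow_le_rpow_of_nonpos (by positivity) ?_ (by linarith)
        rw [abs_div, abs_of_pos hp']
        linarith
    _ = (p : ℝ) ^ σ * |x| ^ (-σ) := by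
        rw [Real.div_rpow hx0.le hp'.le, Real.rpow_neg hp'.le, div_inv_eq_mul, mul_comm]

theorem summable_rescaledIntegrand {p : ℕ} (hp : p ≠ 0) (t : ℝ) :
    Summable fun n : ℤ => rescaledIntegrand a b p t n :=
  summable_of_isBigO (Real.summable_abs_int_rpow hab)
    ((isBigO_rescaledIntegrand hab hp t).comp_tendsto Int.tendsto_coe_cofinite)

theorem summable_riemannTerm {p : ℕ} (hp : p ≠ 0) (t : ℝ) (k : ℤ) :
    Summable (riemannTerm a b p t k) := by
  have hinj : Function.Injective fun ℓ : ℤ => ℓ * p + k := fun x y h =>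
    mul_right_cancel₀ (Nat.cast_ne_zero.2 hp) (add_right_cancel h)
  refine ((summable_rescaledIntegrand hab hp t).comp_injective hinj).congr fun ℓ => ?_
  exact (riemannTerm_eq_rescaledIntegrand hp t k ℓ).symm

/-- Division with remainder, `n = ℓp + k` with `0 ≤ k < p`; absolute convergence permits the
regrouping. -/
theorem sum_riemannPart {p : ℕ} (hp : p ≠ 0) (t : ℝ) :
    ∑ k ∈ Finset.range p, riemannPart a b p t k =
      1 / (p : ℂ) * ∑' n : ℤ, rescaledIntegrand a b p t n := by
  have : NeZero p := ⟨hp⟩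
  have hs := summable_rescaledIntegrand hab hp t
  have he : ∀ x : ℤ × Fin p, rescaledIntegrand a b p t (((Int.divModEquiv p).symm x : ℤ) : ℝ) =
      riemannTerm a b p t (x.2 : ℕ) x.1 := fun x => by
    rw [riemannTerm_eq_rescaledIntegrand hp]
    rfl
  rw [← (Int.divModEquiv p).symm.tsum_eq]
  simp only [he]
  have hs' : Summable fun x : ℤ × Fin p => riemannTerm a b p t (x.2 : ℕ) x.1 :=
    ((Int.divModEquiv p).symm.summable_iff.2 hs).congr he
  have hcomm : ∑' x : ℤ × Fin p, riemannTerm a b p t (x.2 : ℕ) x.1 =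
      ∑' (k : Fin p) (ℓ : ℤ), riemannTerm a b p t (k : ℕ) ℓ := by
    rw [← (Equiv.prodComm (Fin p) ℤ).tsum_eq]
    exact ((Equiv.prodComm (Fin p) ℤ).summable_iff.2 hs').tsum_prod
  rw [hcomm, tsum_fintype, Finset.sum_range, Finset.mul_sum]
  rfl

omit hab in
theorem fourier_rescaledIntegrand {p : ℕ} (hp : p ≠ 0) (t ξ : ℝ) :
    FourierTransform.fourier (rescaledIntegrand a b p t) ξ = p *
      ∫ x : ℝ, gammaProd a b x *
        Complex.exp (-Complex.I * x * ((t + 2 * Real.pi * p * ξ : ℝ) : ℂ)) := by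
  have hp' : (p : ℂ) ≠ 0 := Nat.cast_ne_zero.2 hp
  have h := MeasureTheory.Measure.integral_comp_div (fun x : ℝ => gammaProd a b x *
        Complex.exp (-Complex.I * x * ((t + 2 * Real.pi * p * ξ : ℝ) : ℂ))) (p : ℝ)
  rw [abs_of_nonneg p.cast_nonneg, Complex.real_smul, Complex.ofReal_natCast] at h
  rw [Real.fourier_eq', ← h]
  congr 1
  ext v
  rw [rescaledIntegrand, smul_eq_mul, mul_left_comm, ← Complex.exp_add]
  congr 2
  push_cast [RCLike.inner_apply, conj_trivial]
  field_simp
  ring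

theorem fourier_rescaledIntegrand_eq_zero {p : ℕ} (hp : p ≠ 0) (hmp : m ≤ p) {t : ℝ}
    (ht : |t| ≤ p * Real.pi) {n : ℤ} (hn : n ≠ 0) :
    FourierTransform.fourier (rescaledIntegrand a b p t) (n : ℝ) = 0 := by
  rw [fourier_rescaledIntegrand hp, integral_gammaProd_mul_exp_eq_zero hab, mul_zero]
  have hpi := Real.pi_pos
  have hmp' : (m : ℝ) ≤ p := Nat.cast_le.2 hmp
  have hn1 : (1 : ℝ) ≤ |(n : ℝ)| := by exact_mod_cast Int.one_le_abs hn
  have h1 : |2 * Real.pi * p * n| - |t| ≤ |t + 2 * Real.pi * p * n| := by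
    have := abs_sub_abs_le_abs_sub (2 * Real.pi * p * n) (-t)
    rwa [abs_neg, sub_neg_eq_add, add_comm _ t] at this
  rw [abs_mul, abs_of_nonneg (by positivity : 0 ≤ 2 * Real.pi * p)] at h1
  have h2 : 2 * Real.pi * p ≤ 2 * Real.pi * p * |(n : ℝ)| :=
    le_mul_of_one_le_right (by positivity) hn1
  have h3 : m * Real.pi ≤ p * Real.pi := by gcongr
  linarith

theorem tsum_rescaledIntegrand {p : ℕ} (hp : p ≠ 0) (hmp : m ≤ p) {t : ℝ}
    (ht : |t| ≤ p * Real.pi) :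
    ∑' n : ℤ, rescaledIntegrand a b p t n =
      p * ∫ x : ℝ, gammaProd a b x * Complex.exp (-Complex.I * x * t) := by
  have h0 := fun (n : ℤ) (hn : n ≠ 0) => fourier_rescaledIntegrand_eq_zero hab hp hmp ht hn
  -- Summability on the Fourier side is free, since only the coefficient at 0 can be nonzero.
  -- Poisson's formula is evaluated at the point 0.
  have h := Real.tsum_eq_tsum_fourier_of_rpow_decay_of_summable
    (continuous_rescaledIntegrand a b p t) hab (isBigO_rescaledIntegrand hab hp t)
    (summable_of_ne_finset_zero (s := {0}) fun n hn => h0 n (by simpa using hn)) 0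
  have hsingle : ∑' n : ℤ, FourierTransform.fourier (rescaledIntegrand a b p t) (n : ℝ) *
      fourier n ((0 : ℝ) : UnitAddCircle) = _ :=
    tsum_eq_single 0 fun n hn => by rw [h0 n hn, zero_mul]
  rw [hsingle] at h
  simpa [fourier_rescaledIntegrand hp] using h

end

/-! ### The theorem. -/

theorem theorem4p2 (m : ℕ) (a b : Fin m → ℂ)
    (hab : 1 < ∑ j, (a j + b j + 1).re)
    (p : ℕ) (hp : m ≤ p) (t : ℝ) (ht : |t| ≤ p * Real.pi) :
    MeasureTheory.Integrable
        (fun x : ℝ => gammaProd a b x * Complex.exp (-Complex.I * x * t)) ∧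
    (∀ k : ℤ, Summable (riemannTerm a b p t k)) ∧
    (∫ x : ℝ, gammaProd a b x * Complex.exp (-Complex.I * x * t)) =
        ∑ k ∈ Finset.range p, riemannPart a b p t k ∧
    (∀ k : ℤ,
      BilateralWellDefined (fun j => -b j + (k : ℂ) / p) (fun j => a j + 1 + (k : ℂ) / p) →
      Summable (bilateralTerm (fun j => -b j + (k : ℂ) / p) (fun j => a j + 1 + (k : ℂ) / p)
          ((-1) ^ m * Complex.exp (-Complex.I * t))) ∧
      riemannPart a b p t k =
        1 / (p : ℂ) * coeffC a b p k * Complex.exp (-Complex.I * ((k : ℂ) / p) * t) *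
          bilateralH (fun j => -b j + (k : ℂ) / p) (fun j => a j + 1 + (k : ℂ) / p)
            ((-1) ^ m * Complex.exp (-Complex.I * t))) := by
  -- `p = 0` would force `m = 0`, and then `hab` would compare 1 with an empty sum.
  have hp0 : p ≠ 0 := by
    rintro rfl
    obtain rfl := Nat.le_zero.1 hp
    simp at hab
    linarith
  have hp' : (p : ℂ) ≠ 0 := Nat.cast_ne_zero.2 hp0
  refine ⟨integrable_gammaProd_mul_exp hab t, summable_riemannTerm hab hp0 t, ?_, fun k hk => ?_⟩
  · rw [sum_riemannPart hab hp0, tsum_rescaledIntegrand hab hp0 hp ht, one_div,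
      inv_mul_cancel_left₀ hp']
  · have hterm := riemannTerm_eq_bilateralTerm t hk
    constructor
    · refine (summable_mul_left_iff (mul_ne_zero (coeffC_ne_zero hk) (Complex.exp_ne_zero _))).1
        ((summable_riemannTerm hab hp0 t k).congr hterm)
    · rw [riemannPart, bilateralH, tsum_congr hterm, tsum_mul_left]
      ring
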